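/- For real $x$ and an integer $k \ge 1$ let $\pi_{2k}(x)$ be the number of primes $p \le x$ such that $p+2k$ is also prime. Let $C > 1/2$ be a constant and let $E = E(x)$ be a real-valued function with $E(x) \ge C\log x$ for all sufficiently large $x$ and $E(x) = o(x/\log^2 x)$ as $x \to \infty$. Then $$\frac{1}{\lfloor E\rfloor}\sum_{1\le k\le E}\pi_{2k}(x) \;\ge\; \left(1-\frac{1}{2C}\right)\frac{x}{\log^2 x}\,(1+o(1)),$$ that is, for every $\varepsilon > 0$ there is $x_\varepsilon$ such that for all $x \ge x_\varepsilon$ $$\frac{1}{\lfloor E(x)\rfloor}\sum_{1\le k\le E(x)}\pi_{2k}(x) \;\ge\; (1-\varepsilon)\left(1-\frac{1}{2C}\right)\frac{x}{\log^2 x}.$$ -/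

import Mathlib

open Filter Asymptotics

/-- The prime pair counting function `π_d(x)`: the number of primes `p ≤ x` such that `p + d`
is also prime. -/
noncomputable def primePairCount (d : ℕ) (x : ℝ) : ℕ :=
  Set.ncard {p : ℕ | (p : ℝ) ≤ x ∧ p.Prime ∧ (p + d).Prime}

/-- The set counted by `primePairCount` is finite, so its cardinality is the genuine one. -/
theorem primePairCount_set_finite (d : ℕ) (x : ℝ) :
    {p : ℕ | (p : ℝ) ≤ x ∧ p.Prime ∧ (p + d).Prime}.Finite :=
  (Set.finite_Iic ⌊x⌋₊).subset fun _ hp => Nat.le_floor hp.1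

/-- `f(x) ≥ g(x)(1 + o(1))`: for every `ε > 0`, `f(x) ≥ (1 - ε) g(x)` for all large enough `x`. -/
def AsympGE (f g : ℝ → ℝ) : Prop :=
  ∀ ε : ℝ, 0 < ε → ∀ᶠ x in atTop, (1 - ε) * g x ≤ f x

open MeasureTheory Set Topology

/-! Let N be the number of odd primes up to x, K = ⌊E⌋, H = 2K + 2, and Q the sum of π_{2k}(x) over
k ≤ K. Cut the integers up to x into blocks of length H. Distinct odd primes in one block differ by
some 2k with 1 ≤ k ≤ K, so at most N + 2Q ordered pairs share a block
(`card_oddPrimesLE_same_block_le`). Cauchy-Schwarz over at most x/H + 1 blocks gives N² ≤ (x/H +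
1)(N + 2Q). As H = o(x) and N ≥ (1 - o(1)) x / log x, 2Q is at least about N (H / log x - 1). Since
H ≥ 2C log x, the bracket is at least (1 - 1/(2C)) H / log x, and H/2 > K gives the claim
(`le_sum_primePairCount`).

Only the lower half of the prime number theorem is needed, and it is proved in Wiener-Ikehara style.
The function ψ(e^u) e^(-u) - 1 is bounded by Chebyshev, and its Laplace transform extends
continuously to the imaginary axis. By Riemann-Lebesgue its Fejér averages tend to 0
(`tendsto_integral_mul_sinc_sq`); monotonicity of ψ removes the averaging
(`eventually_neg_le_of_laplace`). -/

/-! ### The Fejér kernel. -/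

theorem Real.mul_sinc (x : ℝ) : x * Real.sinc x = Real.sin x := by
  rcases eq_or_ne x 0 with rfl | hx
  · simp
  · rw [Real.sinc_of_ne_zero hx]; field_simp

theorem Real.sinc_sq_le (x : ℝ) : Real.sinc x ^ 2 ≤ 2 * (1 + x ^ 2)⁻¹ := by
  rw [← div_eq_mul_inv, le_div_iff₀ (by positivity)]
  have h1 := Real.mul_sinc x
  have h2 := Real.sin_sq_le_one x
  have h3 : Real.sinc x ^ 2 ≤ 1 := by
    rw [sq_le_one_iff_abs_le_one]; exact Real.abs_sinc_le_one x
  rw [← h1] at h2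
  nlinarith

theorem Real.integrable_sinc_sq : Integrable fun x : ℝ => Real.sinc x ^ 2 :=
  (integrable_inv_one_add_sq.const_mul 2).mono'
    (Real.continuous_sinc.pow 2).aestronglyMeasurable
    (Eventually.of_forall fun x => by
      rw [Real.norm_of_nonneg (sq_nonneg _)]; exact Real.sinc_sq_le x)

theorem Real.integral_sinc_sq_pos : 0 < ∫ x : ℝ, Real.sinc x ^ 2 :=
  integral_pos_of_integrable_nonneg_nonzero (x := 0) (Real.continuous_sinc.pow 2)
    Real.integrable_sinc_sq (fun x => sq_nonneg _) (by simp)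

/-- The Fourier transform of the triangle function is the Fejér kernel. -/
theorem integral_triangle_mul_cos {T : ℝ} (hT : 0 < T) (v : ℝ) :
    2 * ∫ t in (0 : ℝ)..T, (1 - t / T) * Real.cos (t * v) = T * Real.sinc (T / 2 * v) ^ 2 := by
  rcases eq_or_ne v 0 with rfl | hv
  · have : ∫ t in (0 : ℝ)..T, (1 - t / T) = T / 2 := by
      rw [intervalIntegral.integral_sub (by simp) (Continuous.intervalIntegrable (by fun_prop) _ _)]
      simp only [intervalIntegral.integral_const, intervalIntegral.integral_div, integral_id,
        smul_eq_mul]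
      field_simp; ring
    simp [this]
    ring
  · have hd : ∀ t : ℝ, HasDerivAt
        (fun t => (1 - t / T) * Real.sin (t * v) / v - Real.cos (t * v) / (T * v ^ 2))
        ((1 - t / T) * Real.cos (t * v)) t := by
      intro t
      have h1 : HasDerivAt (fun t : ℝ => t * v) v t := by
        simpa using (hasDerivAt_id t).mul_const v
      have h2 : HasDerivAt (fun t : ℝ => 1 - t / T) (-(1 / T)) t := by
        simpa using ((hasDerivAt_id t).div_const T).const_sub 1
      convert! ((h2.mul h1.sin).div_const v).sub (h1.cos.div_const (T * v ^ 2)) using 1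
      field_simp; ring
    rw [intervalIntegral.integral_eq_sub_of_hasDerivAt (fun t _ => hd t)
      (Continuous.intervalIntegrable (by fun_prop) _ _)]
    have h0 : T / 2 * v ≠ 0 := by positivity
    have hc : Real.cos (T * v) = 1 - 2 * Real.sin (T / 2 * v) ^ 2 := by
      rw [show T * v = 2 * (T / 2 * v) by ring, Real.cos_two_mul, Real.cos_sq']; ring
    rw [Real.sinc_of_ne_zero h0, hc]
    simp
    field_simp
    ring

theorem integral_triangle_mul_cexp {T : ℝ} (hT : 0 < T) (v : ℝ) :
    ∫ t in (-T)..T, ((1 - |t| / T : ℝ) : ℂ) * Complex.exp (t * v * Complex.I) =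
      ((T * Real.sinc (T / 2 * v) ^ 2 : ℝ) : ℂ) := by
  have hc : Continuous fun t : ℝ => ((1 - |t| / T : ℝ) : ℂ) * Complex.exp (t * v * Complex.I) := by
    fun_prop
  rw [← intervalIntegral.integral_add_adjacent_intervals (b := 0) (hc.intervalIntegrable _ _)
    (hc.intervalIntegrable _ _)]
  have hneg := intervalIntegral.integral_comp_neg (a := 0) (b := T)
    (fun t : ℝ => ((1 - |t| / T : ℝ) : ℂ) * Complex.exp (t * v * Complex.I))
  rw [neg_zero] at hneg
  rw [← hneg, ← intervalIntegral.integral_add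
    (Continuous.intervalIntegrable (by fun_prop) _ _) (hc.intervalIntegrable _ _),
    ← integral_triangle_mul_cos hT v, Complex.ofReal_mul, ← intervalIntegral.integral_ofReal,
    ← intervalIntegral.integral_const_mul]
  refine intervalIntegral.integral_congr fun t ht => ?_
  rw [uIcc_of_le hT.le] at ht
  simp only [abs_neg, abs_of_nonneg ht.1, ← mul_add]
  push_cast
  rw [Complex.cos]
  ring_nf

/-! ### A Tauberian theorem for Laplace transforms. -/

/-- Fubini, legitimate because δ > 0 makes b(u) e^(-δu) integrable; the inner integral over t is
then the Fejér kernel at y - u. -/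
theorem integral_triangle_mul_laplace {b : ℝ → ℝ} (hb : Measurable b) {B : ℝ}
    (hB : ∀ u, |b u| ≤ B) (hb0 : ∀ u ≤ 0, b u = 0) {δ : ℝ} (hδ : 0 < δ) {T : ℝ} (hT : 0 < T)
    (y : ℝ) :
    ∫ t in (-T)..T, ((1 - |t| / T : ℝ) : ℂ) * Complex.exp (t * y * Complex.I) *
        ∫ u : ℝ, (b u : ℂ) * Complex.exp (-(δ + t * Complex.I) * u) =
      ∫ u : ℝ, ((b u * Real.exp (-δ * u) * (T * Real.sinc (T / 2 * (y - u)) ^ 2) : ℝ) : ℂ) := by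
  have hbe : Integrable fun u => b u * Real.exp (-δ * u) := by
    have h0 : IntegrableOn (fun u => B * Real.exp (-δ * u)) (Ioi 0) :=
      (integrableOn_exp_mul_Ioi (by linarith) 0).const_mul B
    refine (h0.integrable_indicator measurableSet_Ioi).mono'
      (by fun_prop) (Eventually.of_forall fun u => ?_)
    rcases le_or_gt u 0 with hu | hu
    · simp [hb0 u hu, hu]
    · rw [indicator_of_mem (mem_Ioi.2 hu), norm_mul, Real.norm_eq_abs,
        Real.norm_of_nonneg (Real.exp_pos _).le]
      exact mul_le_mul_of_nonneg_right (hB u) (Real.exp_pos _).le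
  have hswap : ∫ t in (-T)..T, ∫ u : ℝ, ((1 - |t| / T : ℝ) : ℂ) * 
      Complex.exp (t * (y - u : ℝ) * Complex.I) * (b u * Real.exp (-δ * u) : ℝ) = 
      ∫ u : ℝ, ∫ t in (-T)..T, ((1 - |t| / T : ℝ) : ℂ) * 
      Complex.exp (t * (y - u : ℝ) * Complex.I) * (b u * Real.exp (-δ * u) : ℝ) := by
    rw [intervalIntegral.integral_of_le (by linarith)]
    simp_rw [intervalIntegral.integral_of_le (by linarith : -T ≤ T)]
    refine integral_integral_swap ?_
    have h1 : Integrable (fun _ : ℝ => (1 : ℂ)) (volume.restrict (Ioc (-T) T)) :=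
      integrable_const _
    refine (h1.mul_prod hbe.ofReal).mono ?_ ?_
    · refine AEStronglyMeasurable.mul (Continuous.aestronglyMeasurable (by fun_prop)) ?_
      exact (Measurable.aestronglyMeasurable (by fun_prop))
    · have : ∀ᵐ t ∂(volume.restrict (Ioc (-T) T)), t ∈ Ioc (-T) T :=
        ae_restrict_mem measurableSet_Ioc
      filter_upwards [Measure.quasiMeasurePreserving_fst.ae this] with p hp
      simp only [Function.uncurry, one_mul, norm_mul]
      refine mul_le_of_le_one_left (by positivity) ?_
      rw [← Complex.ofReal_mul, Complex.norm_exp_ofReal_mul_I, mul_one, Complex.norm_real,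
        Real.norm_eq_abs, abs_le]
      have h2 : |p.1| / T ≤ 1 := by
        rw [div_le_one hT, abs_le]; exact ⟨hp.1.le, hp.2⟩
      have h3 : 0 ≤ |p.1| / T := by positivity
      constructor <;> linarith
  calc _ = _ := by
        refine intervalIntegral.integral_congr fun t _ => ?_
        rw [← integral_const_mul]
        congr 1
        ext u
        push_cast
        rw [show -((δ : ℂ) + t * Complex.I) * u = -δ * u + -(t * u * Complex.I) by ring,
          Complex.exp_add,
          show (t : ℂ) * (y - u) * Complex.I = t * y * Complex.I + -(t * u * Complex.I) by ring,
          Complex.exp_add]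
        ring
    _ = _ := hswap
    _ = _ := by
        congr 1
        ext u
        rw [intervalIntegral.integral_mul_const, integral_triangle_mul_cexp hT]
        push_cast
        ring

/-- A bounded function whose Laplace transform extends continuously to the imaginary axis is
annihilated in the limit by convolution with any Fejér kernel. -/
theorem tendsto_integral_mul_sinc_sq {b : ℝ → ℝ} (hb : Measurable b) {B : ℝ}
    (hB : ∀ u, |b u| ≤ B) (hb0 : ∀ u ≤ 0, b u = 0) {G : ℝ → ℝ → ℂ}
    (hG : Continuous (Function.uncurry G))
    (hL : ∀ δ : ℝ, 0 < δ → ∀ t : ℝ, ∫ u : ℝ, (b u : ℂ) * Complex.exp (-(δ + t * Complex.I) * u) = G δ t)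
    {T : ℝ} (hT : 0 < T) :
    Tendsto (fun y : ℝ => ∫ u : ℝ, b u * (T * Real.sinc (T / 2 * (y - u)) ^ 2)) atTop (𝓝 0) := by
  have hker : ∀ y : ℝ, Integrable fun u : ℝ => T * Real.sinc (T / 2 * (y - u)) ^ 2 := fun y =>
    ((Real.integrable_sinc_sq.comp_mul_left' (by positivity : T / 2 ≠ 0)).comp_sub_left y).const_mul T
  have hid : ∀ y : ℝ, ((∫ u : ℝ, b u * (T * Real.sinc (T / 2 * (y - u)) ^ 2) : ℝ) : ℂ) =
      ∫ t in (-T)..T, ((1 - |t| / T : ℝ) : ℂ) * Complex.exp (t * y * Complex.I) * G 0 t := by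
    intro y
    -- Let δ → 0+ in the identity for δ > 0: continuity of G handles the t-side, domination by B
    -- times the kernel the u-side.
    have hl : Tendsto (fun δ : ℝ => ∫ t in (-T)..T,
        ((1 - |t| / T : ℝ) : ℂ) * Complex.exp (t * y * Complex.I) * G δ t) (𝓝[>] 0)
        (𝓝 (∫ t in (-T)..T,
          ((1 - |t| / T : ℝ) : ℂ) * Complex.exp (t * y * Complex.I) * G 0 t)) := by
      have hc : Continuous fun δ : ℝ => ∫ t in (-T)..T,
          ((1 - |t| / T : ℝ) : ℂ) * Complex.exp (t * y * Complex.I) * G δ t := by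
        apply intervalIntegral.continuous_parametric_intervalIntegral_of_continuous'
        have : Continuous fun p : ℝ × ℝ => G p.1 p.2 := hG
        simp only [Function.uncurry_def]
        fun_prop
      exact (hc.tendsto 0).mono_left nhdsWithin_le_nhds
    have hr : Tendsto (fun δ : ℝ => ((∫ u : ℝ,
        b u * Real.exp (-δ * u) * (T * Real.sinc (T / 2 * (y - u)) ^ 2) : ℝ) : ℂ)) (𝓝[>] 0)
        (𝓝 ((∫ u : ℝ, b u * (T * Real.sinc (T / 2 * (y - u)) ^ 2) : ℝ) : ℂ)) := by
      refine (Complex.continuous_ofReal.tendsto _).comp ?_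
      refine tendsto_integral_filter_of_dominated_convergence
        (fun u => B * (T * Real.sinc (T / 2 * (y - u)) ^ 2)) ?_ ?_ ((hker y).const_mul B) ?_
      · refine Eventually.of_forall fun δ => Measurable.aestronglyMeasurable ?_
        have := Real.continuous_sinc.measurable
        fun_prop
      · filter_upwards [self_mem_nhdsWithin] with δ hδ
        refine Eventually.of_forall fun u => ?_
        have hk : 0 ≤ T * Real.sinc (T / 2 * (y - u)) ^ 2 := by positivity
        rw [norm_mul, Real.norm_of_nonneg hk]
        refine mul_le_mul_of_nonneg_right ?_ hk
        rcases le_or_gt u 0 with hu | hu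
        · simpa [hb0 u hu] using hB u
        · rw [norm_mul, Real.norm_eq_abs, Real.norm_of_nonneg (Real.exp_pos _).le]
          refine (mul_le_of_le_one_right (abs_nonneg _) ?_).trans (hB u)
          rw [Real.exp_le_one_iff]
          have : (0 : ℝ) < δ := hδ
          nlinarith
      · refine Eventually.of_forall fun u => ?_
        have : Continuous fun δ : ℝ =>
            b u * Real.exp (-δ * u) * (T * Real.sinc (T / 2 * (y - u)) ^ 2) := by fun_prop
        simpa using (this.tendsto 0).mono_left nhdsWithin_le_nhds
    refine tendsto_nhds_unique hr (hl.congr' ?_)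
    filter_upwards [self_mem_nhdsWithin] with δ hδ
    rw [← integral_complex_ofReal, ← integral_triangle_mul_laplace hb hB hb0 hδ hT y]
    refine intervalIntegral.integral_congr fun t _ => ?_
    rw [hL δ hδ t]
  -- Riemann-Lebesgue for the truncated weight times G 0; the frequency -y/(2π) matches the
  -- normalization of the Fourier character.
  have hRL := Real.tendsto_integral_exp_smul_cocompact
    (indicator (Ioc (-T) T) fun t : ℝ => ((1 - |t| / T : ℝ) : ℂ) * G 0 t)
  have hw : Tendsto (fun y : ℝ => -y / (2 * Real.pi)) atTop (cocompact ℝ) := by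
    refine Tendsto.mono_right ?_ atBot_le_cocompact
    exact tendsto_neg_atTop_atBot.atBot_div_const (by positivity)
  have hc : Tendsto (fun y : ℝ =>
      ((∫ u : ℝ, b u * (T * Real.sinc (T / 2 * (y - u)) ^ 2) : ℝ) : ℂ)) atTop (𝓝 0) := by
    refine (hRL.comp hw).congr fun y => ?_
    rw [hid y, intervalIntegral.integral_of_le (by linarith), ← integral_indicator measurableSet_Ioc]
    simp only [Function.comp]
    congr 1
    ext t
    by_cases ht : t ∈ Ioc (-T) T
    · rw [indicator_of_mem ht, indicator_of_mem ht, Circle.smul_def, Real.fourierChar_apply,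
        smul_eq_mul]
      have : ((2 * Real.pi * -(t * (-y / (2 * Real.pi))) : ℝ) : ℂ) = t * y := by
        rw [← Complex.ofReal_mul]
        congr 1
        field_simp
      rw [this]
      ring
    · rw [indicator_of_notMem ht, indicator_of_notMem ht, smul_zero]
  exact (Complex.continuous_re.tendsto _).comp hc

/-- The substitution u = y - w/l with T = 2l fixes the kernel and moves the concentration parameter
into the argument of b. -/
theorem tendsto_integral_comp_add_div_mul_sinc_sq {b : ℝ → ℝ} (hb : Measurable b) {B : ℝ}
    (hB : ∀ u, |b u| ≤ B) (hb0 : ∀ u ≤ 0, b u = 0) {G : ℝ → ℝ → ℂ}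
    (hG : Continuous (Function.uncurry G))
    (hL : ∀ δ : ℝ, 0 < δ → ∀ t : ℝ, ∫ u : ℝ, (b u : ℂ) * Complex.exp (-(δ + t * Complex.I) * u) = G δ t)
    {l : ℝ} (hl : 0 < l) :
    Tendsto (fun y : ℝ => ∫ w : ℝ, b (y - w / l) * Real.sinc w ^ 2) atTop (𝓝 0) := by
  have h := (tendsto_integral_mul_sinc_sq hb hB hb0 hG hL (mul_pos two_pos hl)).const_mul (1 / 2)
  rw [mul_zero] at h
  refine h.congr fun y => ?_
  have h1 := integral_sub_left_eq_self
    (fun u => b u * (2 * l * Real.sinc (2 * l / 2 * (y - u)) ^ 2)) volume y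
  have h2 := Measure.integral_comp_div
    (fun w => b (y - w) * (2 * l * Real.sinc (2 * l / 2 * (y - (y - w))) ^ 2)) l
  rw [← h1, eq_comm]
  rw [smul_eq_mul, abs_of_pos hl] at h2
  have h3 : ∀ w : ℝ, b (y - w / l) * (2 * l * Real.sinc (2 * l / 2 * (y - (y - w / l))) ^ 2) =
      2 * l * (b (y - w / l) * Real.sinc w ^ 2) := by
    intro w
    rw [show 2 * l / 2 * (y - (y - w / l)) = w by field_simp; ring]
    ring
  simp_rw [h3] at h2
  rw [integral_const_mul] at h2
  have : (∫ w : ℝ, b (y - w / l) * Real.sinc w ^ 2) * (2 * l) = _ := (mul_comm _ _).trans h2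
  rw [← eq_div_iff (by positivity)] at this
  rw [this, mul_comm 2 l, mul_div_mul_left _ _ hl.ne', div_eq_mul_one_div, mul_comm]

/-- Tauberian theorem, lower bound. -/
theorem eventually_neg_le_of_laplace {b : ℝ → ℝ} (hb : Measurable b) {B : ℝ}
    (hB : ∀ u, |b u| ≤ B) (hb0 : ∀ u ≤ 0, b u = 0) {G : ℝ → ℝ → ℂ}
    (hG : Continuous (Function.uncurry G))
    (hL : ∀ δ : ℝ, 0 < δ → ∀ t : ℝ, ∫ u : ℝ, (b u : ℂ) * Complex.exp (-(δ + t * Complex.I) * u) = G δ t)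
    (hmono : MonotoneOn (fun u => Real.exp u * (b u + 1)) (Ioi 0)) {ε : ℝ} (hε : 0 < ε) :
    ∀ᶠ y in atTop, -ε ≤ b y := by
  set I := ∫ x : ℝ, Real.sinc x ^ 2 with hI
  have hI0 : 0 < I := Real.integral_sinc_sq_pos
  -- By `hmono`, b y < -ε will force b ≤ -ε/2 on all of [y - h, y].
  obtain ⟨h, hh0, hh⟩ : ∃ h > 0, ∀ u ∈ Icc 0 h, Real.exp u * (1 - ε) - 1 ≤ -(ε / 2) := by
    have hc : Continuous fun u : ℝ => Real.exp u * (1 - ε) - 1 := by fun_prop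
    have h1 : ∀ᶠ u in 𝓝 (0 : ℝ), Real.exp u * (1 - ε) - 1 < -(ε / 2) :=
      (hc.tendsto 0).eventually_lt_const (by simp; linarith)
    obtain ⟨h, hh0, hh⟩ := Metric.eventually_nhds_iff.1 h1
    refine ⟨h / 2, by positivity, fun u hu => (hh ?_).le⟩
    rw [Real.dist_0_eq_abs, abs_of_nonneg hu.1]
    linarith [hu.2]
  obtain ⟨R, hR0, hR⟩ : ∃ R > 0, (B + ε / 2) *
      ∫ w : ℝ, (Icc (-R) R)ᶜ.indicator (fun w => Real.sinc w ^ 2) w < ε / 4 * I := by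
    have ht : Tendsto (fun R : ℝ => ∫ w : ℝ, (Icc (-R) R)ᶜ.indicator
        (fun w => Real.sinc w ^ 2) w) atTop (𝓝 (∫ w : ℝ, (0 : ℝ))) := by
      refine tendsto_integral_filter_of_dominated_convergence (fun w => Real.sinc w ^ 2) ?_ ?_
        Real.integrable_sinc_sq ?_
      · exact Eventually.of_forall fun R => 
          Real.integrable_sinc_sq.aestronglyMeasurable.indicator measurableSet_Icc.compl
      · refine Eventually.of_forall fun R => Eventually.of_forall fun w => ?_
        refine (norm_indicator_le_norm_self _ _).trans ?_
        rw [Real.norm_of_nonneg (sq_nonneg _)]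
      · refine Eventually.of_forall fun w => tendsto_const_nhds.congr' ?_
        filter_upwards [eventually_ge_atTop |w|] with R hR
        rw [indicator_of_notMem]
        simpa using abs_le.1 hR
    have ht' := ht.const_mul (B + ε / 2)
    rw [integral_zero, mul_zero] at ht'
    obtain ⟨R, h1, h2⟩ := ((ht'.eventually_lt_const (by positivity : 0 < ε / 4 * I)).and
      (eventually_gt_atTop 0)).exists
    exact ⟨R, h2, h1⟩
  -- At this scale, centred at y - h/2, the range |w| ≤ R corresponds exactly to [y - h, y].
  have hl : 0 < 2 * R / h := by positivity
  have hlim := (tendsto_integral_comp_add_div_mul_sinc_sq hb hB hb0 hG hL hl).comp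
    (tendsto_atTop_add_const_right atTop (-(h / 2)) tendsto_id)
  filter_upwards [hlim.eventually_const_lt (by linarith [mul_pos hε hI0] : -(ε / 4 * I) < 0),
    eventually_gt_atTop h] with y hy hyh
  by_contra! hcon
  have hpt : ∀ w : ℝ, b (y + -(h / 2) - w / (2 * R / h)) * Real.sinc w ^ 2 ≤
      -(ε / 2) * Real.sinc w ^ 2 +
        (B + ε / 2) * (Icc (-R) R)ᶜ.indicator (fun w => Real.sinc w ^ 2) w := by
    intro w
    by_cases hw : w ∈ Icc (-R) R
    · rw [indicator_of_notMem (by simpa using hw), mul_zero, add_zero]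
      refine mul_le_mul_of_nonneg_right ?_ (sq_nonneg _)
      set u := y + -(h / 2) - w / (2 * R / h) with hu
      have hw1 : w / (2 * R / h) ≤ h / 2 := by
        rw [div_le_iff₀ hl]; field_simp; linarith [hw.2]
      have hw2 : -(h / 2) ≤ w / (2 * R / h) := by
        rw [le_div_iff₀ hl]; field_simp; linarith [hw.1]
      have hm := hmono (mem_Ioi.2 (by linarith : 0 < u)) (mem_Ioi.2 (by linarith : 0 < y))
        (by linarith : u ≤ y)
      have h1 : b u + 1 ≤ Real.exp (y - u) * (b y + 1) := by
        rw [Real.exp_sub, div_mul_eq_mul_div, le_div_iff₀ (Real.exp_pos _), mul_comm]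
        exact hm
      have h2 : Real.exp (y - u) * (b y + 1) ≤ Real.exp (y - u) * (1 - ε) :=
        mul_le_mul_of_nonneg_left (by linarith) (Real.exp_pos _).le
      have h3 := hh (y - u) ⟨by linarith, by linarith⟩
      linarith
    · rw [indicator_of_mem (by simpa using hw)]
      have := mul_le_mul_of_nonneg_right
        ((abs_le.1 (hB (y + -(h / 2) - w / (2 * R / h)))).2) (sq_nonneg (Real.sinc w))
      linarith
  have hi1 : Integrable fun w : ℝ => -(ε / 2) * Real.sinc w ^ 2 :=
    Real.integrable_sinc_sq.const_mul _
  have hi2 : Integrable fun w : ℝ =>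
      (B + ε / 2) * (Icc (-R) R)ᶜ.indicator (fun w => Real.sinc w ^ 2) w :=
    (Real.integrable_sinc_sq.indicator measurableSet_Icc.compl).const_mul _
  have hi3 : Integrable fun w : ℝ => b (y + -(h / 2) - w / (2 * R / h)) * Real.sinc w ^ 2 := by
    refine (Real.integrable_sinc_sq.const_mul B).mono' ?_ (Eventually.of_forall fun w => ?_)
    · have := Real.continuous_sinc.measurable
      exact Measurable.aestronglyMeasurable (by fun_prop)
    · rw [norm_mul, Real.norm_of_nonneg (sq_nonneg (Real.sinc w))]
      exact mul_le_mul_of_nonneg_right (hB _) (sq_nonneg _)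
  have := integral_mono hi3 (hi1.add hi2) hpt
  simp only [Pi.add_apply] at this
  rw [integral_add hi1 hi2, integral_const_mul, integral_const_mul, ← hI] at this
  simp only [Function.comp, id] at hy
  linarith [mul_pos hε hI0]

/-! ### The lower bound in the prime number theorem. -/

open ArithmeticFunction in
-- Modulus 1 has a single residue class, so the auxiliary function from Dirichlet's theorem is -ζ'/ζ
-- with its pole removed. Its continuity on Re s ≥ 1 is where nonvanishing of ζ on Re s = 1 enters.
theorem LSeries_vonMangoldt_eq_residueClassAux {s : ℂ} (hs : 1 < s.re) :
    LSeries (fun n => (vonMangoldt n : ℂ)) s =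
      vonMangoldt.LFunctionResidueClassAux (1 : ZMod 1) s + 1 / (s - 1) := by
  have h := vonMangoldt.eqOn_LFunctionResidueClassAux (isUnit_one : IsUnit (1 : ZMod 1))
    (mem_ofPred.2 hs)
  have hr : vonMangoldt.residueClass (1 : ZMod 1) = fun n => vonMangoldt n := by
    ext n
    have hn : n ∈ {n : ℕ | (n : ZMod 1) = 1} := Subsingleton.elim (n : ZMod 1) 1
    exact indicator_of_mem hn _
  rw [h, hr]
  simp

theorem LSeries_vonMangoldt_eq_mul_integral_psi {s : ℂ} (hs : 1 < s.re) :
    LSeries (fun n => (ArithmeticFunction.vonMangoldt n : ℂ)) s =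
      s * ∫ t in Ioi (1 : ℝ), (Chebyshev.psi t : ℂ) * (t : ℂ) ^ (-(s + 1)) := by
  rw [LSeries_eq_mul_integral_of_nonneg (fun n => ArithmeticFunction.vonMangoldt n) zero_le_one hs
    ?_ fun n => ArithmeticFunction.vonMangoldt_nonneg]
  · congr 2
    ext t
    rw [Chebyshev.psi, ← Finset.Icc_add_one_left_eq_Ioc]
    push_cast
    rfl
  · refine IsBigO.of_bound (Real.log 4 + 4) (Eventually.of_forall fun n => ?_)
    have h := Chebyshev.psi_le_const_mul_self (Nat.cast_nonneg (α := ℝ) n)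
    rw [Chebyshev.psi, ← Finset.Icc_add_one_left_eq_Ioc, Nat.floor_natCast] at h
    rw [Real.norm_of_nonneg (Finset.sum_nonneg fun _ _ =>
      ArithmeticFunction.vonMangoldt_nonneg), Real.rpow_one, Real.norm_of_nonneg (by positivity)]
    exact h

/-- The relative error in the prime number theorem, on the logarithmic scale. -/
noncomputable def psiError (u : ℝ) : ℝ :=
  (Ioi (0 : ℝ)).indicator (fun u => Chebyshev.psi (Real.exp u) * Real.exp (-u) - 1) u

theorem psiError_of_pos {u : ℝ} (hu : 0 < u) :
    psiError u = Chebyshev.psi (Real.exp u) * Real.exp (-u) - 1 :=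
  indicator_of_mem (mem_Ioi.2 hu) _

theorem psiError_of_nonpos {u : ℝ} (hu : u ≤ 0) : psiError u = 0 :=
  indicator_of_notMem (by simpa using hu) _

theorem measurable_psiError : Measurable psiError := by
  have := Chebyshev.psi_mono.measurable
  exact Measurable.indicator (by fun_prop) measurableSet_Ioi

theorem psi_exp_mul_exp_neg_le (u : ℝ) :
    Chebyshev.psi (Real.exp u) * Real.exp (-u) ≤ Real.log 4 + 4 := by
  rw [Real.exp_neg, ← div_eq_mul_inv, div_le_iff₀ (Real.exp_pos u)]
  exact Chebyshev.psi_le_const_mul_self (Real.exp_pos u).le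

theorem abs_psiError_le (u : ℝ) : |psiError u| ≤ Real.log 4 + 4 := by
  have h4 : 0 ≤ Real.log 4 := Real.log_nonneg (by norm_num)
  rcases le_or_gt u 0 with hu | hu
  · rw [psiError_of_nonpos hu, abs_zero]; positivity
  · rw [psiError_of_pos hu, abs_le]
    have h1 := psi_exp_mul_exp_neg_le u
    have h2 : 0 ≤ Chebyshev.psi (Real.exp u) * Real.exp (-u) :=
      mul_nonneg (Chebyshev.psi_nonneg _) (Real.exp_pos _).le
    constructor <;> linarith

theorem monotoneOn_exp_mul_psiError_add_one :
    MonotoneOn (fun u => Real.exp u * (psiError u + 1)) (Ioi 0) := by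
  have h : ∀ u ∈ Ioi (0 : ℝ), Real.exp u * (psiError u + 1) = Chebyshev.psi (Real.exp u) := by
    intro u hu
    rw [psiError_of_pos hu, Real.exp_neg]
    field_simp [(Real.exp_pos u).ne']
    ring
  intro u hu v hv huv
  simp only [h u hu, h v hv]
  exact Chebyshev.psi_mono (Real.exp_le_exp.2 huv)

/-- With t = e^u this is the Mellin integral of ψ at 1 + s minus 1/s; the pole of the L-series
cancels that term. -/
theorem laplace_psiError {s : ℂ} (hs : 0 < s.re) :
    ∫ u : ℝ, (psiError u : ℂ) * Complex.exp (-s * u) =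
      (ArithmeticFunction.vonMangoldt.LFunctionResidueClassAux (1 : ZMod 1) (1 + s) - 1) /
        (1 + s) := by
  have hs1 : 1 < (1 + s).re := by simpa using hs
  have hs0 : s ≠ 0 := fun h => by simp [h] at hs
  have hs10 : 1 + s ≠ 0 := fun h => by rw [h] at hs1; norm_num at hs1
  have hns : (-s).re < 0 := by simpa using hs
  have hexp : IntegrableOn (fun u : ℝ => Complex.exp (-s * u)) (Ioi 0) :=
    integrableOn_exp_mul_complex_Ioi hns 0
  have hpsi : IntegrableOn (fun u : ℝ =>
      ((Chebyshev.psi (Real.exp u) * Real.exp (-u) : ℝ) : ℂ) * Complex.exp (-s * u)) (Ioi 0) := by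
    refine Integrable.bdd_mul (c := Real.log 4 + 4) hexp ?_ (Eventually.of_forall fun u => ?_)
    · have := Chebyshev.psi_mono.measurable
      exact Measurable.aestronglyMeasurable (by fun_prop)
    · rw [Complex.norm_real, Real.norm_of_nonneg
        (mul_nonneg (Chebyshev.psi_nonneg _) (Real.exp_pos _).le)]
      exact psi_exp_mul_exp_neg_le u
  have hsub : ∫ u in Ioi (0 : ℝ), ((Chebyshev.psi (Real.exp u) * Real.exp (-u) : ℝ) : ℂ) *
      Complex.exp (-s * u) =
      ∫ t in Ioi (1 : ℝ), (Chebyshev.psi t : ℂ) * (t : ℂ) ^ (-((1 + s) + 1)) := by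
    rw [← Real.exp_zero, ← integral_comp_exp_Ioi]
    refine setIntegral_congr_fun measurableSet_Ioi fun u _ => ?_
    simp only [Complex.real_smul]
    rw [Complex.cpow_def_of_ne_zero (by simp), ← Complex.ofReal_log (Real.exp_pos u).le,
      Real.log_exp]
    push_cast
    rw [mul_assoc, mul_left_comm (Complex.exp u), ← Complex.exp_add, ← Complex.exp_add]
    ring_nf
  have h1 : ∫ u : ℝ, (psiError u : ℂ) * Complex.exp (-s * u) = ∫ u in Ioi (0 : ℝ),
      (((Chebyshev.psi (Real.exp u) * Real.exp (-u) : ℝ) : ℂ) * Complex.exp (-s * u) -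
        Complex.exp (-s * u)) := by
    rw [← integral_indicator measurableSet_Ioi]
    congr 1
    ext u
    rcases le_or_gt u 0 with hu | hu
    · rw [psiError_of_nonpos hu, indicator_of_notMem (by simpa using hu)]
      simp
    · rw [psiError_of_pos hu, indicator_of_mem (mem_Ioi.2 hu)]
      push_cast
      ring
  have h2 := LSeries_vonMangoldt_eq_residueClassAux hs1
  rw [LSeries_vonMangoldt_eq_mul_integral_psi hs1, ← hsub] at h2
  rw [h1, integral_sub hpsi hexp, integral_exp_mul_complex_Ioi hns, eq_div_iff hs10, sub_mul,
    mul_comm _ (1 + s), h2]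
  simp only [add_sub_cancel_left, Complex.ofReal_zero, mul_zero, Complex.exp_zero]
  field_simp
  ring

/-- The lower bound in the prime number theorem for `ψ`. -/
theorem eventually_one_sub_mul_le_psi {ε : ℝ} (hε : 0 < ε) :
    ∀ᶠ x in atTop, (1 - ε) * x ≤ Chebyshev.psi x := by
  set A := ArithmeticFunction.vonMangoldt.LFunctionResidueClassAux (1 : ZMod 1)
  have hA : ContinuousOn A {s | 1 ≤ s.re} :=
    ArithmeticFunction.vonMangoldt.continuousOn_LFunctionResidueClassAux 1
  -- Clamping δ at 0 stays in Re s ≥ 1, giving a function continuous on the whole plane and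
  -- unchanged for δ > 0.
  have hσ : Continuous fun p : ℝ × ℝ => (1 + ((max p.1 0 : ℝ) + p.2 * Complex.I) : ℂ) := by
    fun_prop
  have hre : ∀ p : ℝ × ℝ, 1 ≤ (1 + ((max p.1 0 : ℝ) + p.2 * Complex.I) : ℂ).re := by
    intro p; simp
  have hG : Continuous (Function.uncurry fun δ t : ℝ =>
      (A (1 + ((max δ 0 : ℝ) + t * Complex.I)) - 1) / (1 + ((max δ 0 : ℝ) + t * Complex.I))) := by
    refine ((hA.comp_continuous hσ hre).sub continuous_const).div hσ fun p h => ?_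
    have := hre p
    rw [h] at this
    norm_num at this
  have h := eventually_neg_le_of_laplace measurable_psiError abs_psiError_le
    (fun u hu => psiError_of_nonpos hu) hG (fun δ hδ t => by
      rw [laplace_psiError (by simpa using hδ), max_eq_left hδ.le])
    monotoneOn_exp_mul_psiError_add_one hε
  filter_upwards [Real.tendsto_log_atTop.eventually h, eventually_gt_atTop 1] with x hx hx1
  have hx0 : 0 < x := by linarith
  rw [psiError_of_pos (Real.log_pos hx1), Real.exp_neg, Real.exp_log hx0, ← div_eq_mul_inv] at hx
  rw [← le_div_iff₀ hx0]
  linarith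

open scoped Nat.Prime in
/-- The lower bound in the prime number theorem for `π`. -/
theorem eventually_one_sub_mul_div_log_le_primeCounting {ε : ℝ} (hε : 0 < ε) :
    ∀ᶠ x : ℝ in atTop, (1 - ε) * (x / Real.log x) ≤ (Nat.primeCounting ⌊x⌋₊ : ℝ) := by
  filter_upwards [eventually_one_sub_mul_le_psi hε, eventually_gt_atTop 1] with x hx hx1
  rw [← mul_div_assoc, div_le_iff₀ (Real.log_pos hx1)]
  exact hx.trans (Chebyshev.psi_le_primeCounting_mul_log' x)

/-! ### Prime pairs in short blocks. -/

/-- The odd primes up to `n`. -/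
def oddPrimesLE (n : ℕ) : Finset ℕ := (Nat.primesLE n).erase 2

theorem mem_oddPrimesLE {n p : ℕ} : p ∈ oddPrimesLE n ↔ p ≠ 2 ∧ p ≤ n ∧ p.Prime := by
  rw [oddPrimesLE, Finset.mem_erase, Nat.mem_primesLE]

theorem primeCounting_le_card_oddPrimesLE_add_one (n : ℕ) :
    Nat.primeCounting n ≤ (oddPrimesLE n).card + 1 := by
  rw [← Nat.primesLE_card_eq_primeCounting]
  have := Finset.pred_card_le_card_erase (s := Nat.primesLE n) (a := 2)
  rw [oddPrimesLE]
  omega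

/-- Two odd primes in the same block of length `2 * K + 2` differ by at most `2 * K`. -/
theorem card_oddPrimesLE_same_block_le (K : ℕ) (x : ℝ) (hx : 0 ≤ x) :
    ((oddPrimesLE ⌊x⌋₊ ×ˢ oddPrimesLE ⌊x⌋₊).filter
        fun p => p.1 / (2 * K + 2) = p.2 / (2 * K + 2)).card ≤
      (oddPrimesLE ⌊x⌋₊).card + 2 * ∑ k ∈ Finset.Icc 1 K, primePairCount (2 * k) x := by
  classical
  set S := oddPrimesLE ⌊x⌋₊ with hS
  set A : Finset (Σ _ : ℕ, ℕ) :=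
    (Finset.Icc 1 K).sigma fun k => (primePairCount_set_finite (2 * k) x).toFinset with hA
  have hAcard : A.card = ∑ k ∈ Finset.Icc 1 K, primePairCount (2 * k) x := by
    rw [hA, Finset.card_sigma]
    refine Finset.sum_congr rfl fun k _ => ?_
    rw [primePairCount, ncard_eq_toFinset_card _ (primePairCount_set_finite (2 * k) x)]
  have key : ∀ p ∈ S, ∀ q ∈ S, p / (2 * K + 2) = q / (2 * K + 2) → p < q →
      ∃ k, (⟨k, p⟩ : Σ _ : ℕ, ℕ) ∈ A ∧ p + 2 * k = q := by
    intro p hp q hq hpq hlt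
    rw [hS, mem_oddPrimesLE] at hp hq
    obtain ⟨a, ha⟩ := hp.2.2.odd_of_ne_two hp.1
    obtain ⟨b, hb⟩ := hq.2.2.odd_of_ne_two hq.1
    have h1 := Nat.div_add_mod p (2 * K + 2)
    have h2 := Nat.div_add_mod q (2 * K + 2)
    have h3 := Nat.mod_lt q (by omega : 2 * K + 2 > 0)
    rw [hpq] at h1
    -- Both primes are odd, so their difference is even; being less than 2K + 2, it is at most 2K.
    have hk : p + 2 * (b - a) = q := by omega
    have hk1 : 1 ≤ b - a := by omega
    have hkK : b - a ≤ K := by omega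
    refine ⟨b - a, ?_, hk⟩
    rw [hA, Finset.mem_sigma, Finset.mem_Icc, Finite.mem_toFinset]
    exact ⟨⟨hk1, hkK⟩, (Nat.le_floor_iff hx).1 hp.2.1, hp.2.2, hk.symm ▸ hq.2.2⟩
  -- The diagonal contributes the term N, and the two orders of a pair the factor 2.
  have hsub : ((S ×ˢ S).filter fun p => p.1 / (2 * K + 2) = p.2 / (2 * K + 2)) ⊆
      (S.image fun p => (p, p)) ∪ (A.image (fun a => (a.2, a.2 + 2 * a.1)) ∪
        A.image (fun a => (a.2 + 2 * a.1, a.2))) := by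
    rintro ⟨p, q⟩ h
    rw [Finset.mem_filter, Finset.mem_product] at h
    obtain ⟨⟨hp, hq⟩, hpq⟩ := h
    simp only at hp hq hpq
    rw [Finset.mem_union, Finset.mem_union, Finset.mem_image, Finset.mem_image, Finset.mem_image]
    rcases lt_trichotomy p q with hlt | rfl | hlt
    · obtain ⟨k, hk, rfl⟩ := key p hp q hq hpq hlt
      exact Or.inr (Or.inl ⟨⟨k, p⟩, hk, rfl⟩)
    · exact Or.inl ⟨p, hp, rfl⟩
    · obtain ⟨k, hk, rfl⟩ := key q hq p hp hpq.symm hlt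
      exact Or.inr (Or.inr ⟨⟨k, q⟩, hk, rfl⟩)
  calc _ ≤ _ := Finset.card_le_card hsub
    _ ≤ _ := Finset.card_union_le _ _
    _ ≤ S.card + (A.card + A.card) := add_le_add Finset.card_image_le
        ((Finset.card_union_le _ _).trans (add_le_add Finset.card_image_le Finset.card_image_le))
    _ = _ := by rw [hAcard]; ring

/-- Cauchy-Schwarz for the fibre sizes, whose squares sum to the number of pairs in a common fibre.
-/
theorem sq_card_le_card_mul_card_same_fiber {α β : Type*} [DecidableEq β] {s : Finset α}
    {t : Finset β} {f : α → β} (hf : ∀ a ∈ s, f a ∈ t) :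
    s.card ^ 2 ≤ t.card * ((s ×ˢ s).filter fun p => f p.1 = f p.2).card := by
  have h1 : s.card = ∑ b ∈ t, (s.filter fun a => f a = b).card :=
    Finset.card_eq_sum_card_fiberwise hf
  have h2 : ((s ×ˢ s).filter fun p => f p.1 = f p.2).card =
      ∑ b ∈ t, (s.filter fun a => f a = b).card ^ 2 := by
    rw [Finset.card_eq_sum_card_fiberwise (f := fun p => f p.1) (t := t)]
    · refine Finset.sum_congr rfl fun b _ => ?_
      rw [sq, ← Finset.card_product]
      congr 1
      ext p
      simp only [Finset.mem_filter, Finset.mem_product]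
      constructor
      · rintro ⟨⟨⟨h1, h2⟩, h3⟩, h4⟩
        exact ⟨⟨h1, h4⟩, h2, h3 ▸ h4⟩
      · rintro ⟨⟨h1, h2⟩, h3, h4⟩
        exact ⟨⟨⟨h1, h3⟩, h2.trans h4.symm⟩, h2⟩
    · intro p hp
      rw [Finset.mem_coe, Finset.mem_filter, Finset.mem_product] at hp
      exact hf _ hp.1.1
  rw [h2, h1]
  exact sq_sum_le_card_mul_sum_sq

theorem sq_card_oddPrimesLE_le (K : ℕ) {x : ℝ} (hx : 0 ≤ x) :
    (oddPrimesLE ⌊x⌋₊).card ^ 2 ≤ (⌊x⌋₊ / (2 * K + 2) + 1) *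
      ((oddPrimesLE ⌊x⌋₊).card + 2 * ∑ k ∈ Finset.Icc 1 K, primePairCount (2 * k) x) := by
  have h := sq_card_le_card_mul_card_same_fiber (s := oddPrimesLE ⌊x⌋₊)
    (t := Finset.range (⌊x⌋₊ / (2 * K + 2) + 1)) (f := fun p => p / (2 * K + 2)) fun p hp =>
      Finset.mem_range.2 (Nat.lt_succ_of_le (Nat.div_le_div_right (mem_oddPrimesLE.1 hp).2.1))
  rw [Finset.card_range] at h
  exact h.trans (Nat.mul_le_mul_left _ (card_oddPrimesLE_same_block_le K x hx))

/-! ### Asymptotics and choice of parameters. -/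

/-- The block count, combined with a lower bound `(1 - η) x / log x` for the number of odd primes
and the assumption that blocks are short compared with `x`. -/
theorem le_sum_primePairCount {C η x : ℝ} {K : ℕ} (hC : 1 / 2 < C) (hη0 : 0 < η) (hη1 : η < 1)
    (hη : 1 / (2 * C) < (1 - η) / (1 + η)) (hx : 1 < x) (hK : C * Real.log x ≤ K + 1)
    (hKx : 2 * (K : ℝ) + 2 ≤ η * x)
    (hN : (1 - η) * (x / Real.log x) ≤ ((oddPrimesLE ⌊x⌋₊).card : ℝ)) :
    K * ((1 - η) * ((1 - η) / (1 + η) - 1 / (2 * C)) * (x / Real.log x ^ 2)) ≤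
      ∑ k ∈ Finset.Icc 1 K, (primePairCount (2 * k) x : ℝ) := by
  have hC0 : 0 < C := by linarith
  have hl : 0 < Real.log x := Real.log_pos hx
  have hx0 : 0 < x := by linarith
  set N : ℝ := ((oddPrimesLE ⌊x⌋₊).card : ℝ) with hNdef
  set Q : ℝ := ∑ k ∈ Finset.Icc 1 K, (primePairCount (2 * k) x : ℝ) with hQ
  set H : ℝ := 2 * (K : ℝ) + 2 with hH
  set y := x / Real.log x with hy
  set ρ := (1 - η) / (1 + η) with hρ
  set r := H / Real.log x with hr
  have hH0 : 0 < H := by positivity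
  have hy0 : 0 < y := by positivity
  have hr0 : 0 < r := by positivity
  have hr1 : 2 * C ≤ r := by
    rw [hr, le_div_iff₀ hl]; linarith
  have hN0 : 0 < N := lt_of_lt_of_le (mul_pos (by linarith) hy0) hN
  have hM : ((⌊x⌋₊ / (2 * K + 2) : ℕ) : ℝ) + 1 ≤ (1 + η) * x / H := by
    have h1 : ((⌊x⌋₊ / (2 * K + 2) : ℕ) : ℝ) ≤ x / H := by
      refine Nat.cast_div_le.trans ?_
      push_cast
      exact div_le_div_of_nonneg_right (Nat.floor_le hx0.le) hH0.le
    have h2 : 1 ≤ η * x / H := by rwa [one_le_div hH0]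
    calc _ ≤ x / H + η * x / H := add_le_add h1 h2
      _ = _ := by ring
  have hcs : N ^ 2 ≤ (1 + η) * x / H * (N + 2 * Q) := by
    have h : N ^ 2 ≤ (((⌊x⌋₊ / (2 * K + 2) : ℕ) : ℝ) + 1) * (N + 2 * Q) := by
      rw [hNdef, hQ]
      exact_mod_cast sq_card_oddPrimesLE_le K hx0.le
    exact h.trans (mul_le_mul_of_nonneg_right hM (by positivity))
  have h1 : N * (ρ * r) ≤ N + 2 * Q := by
    have h2 : N * ((1 - η) * y) ≤ (1 + η) * x / H * (N + 2 * Q) := by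
      refine le_trans ?_ hcs
      rw [sq]
      exact mul_le_mul_of_nonneg_left hN hN0.le
    have h3 : N * (ρ * r) = N * ((1 - η) * y) / ((1 + η) * x / H) := by
      rw [hρ, hr, hy]; field_simp
    rw [h3, div_le_iff₀ (by positivity), mul_comm (N + 2 * Q)]
    exact h2
  -- The diagonal loss 1 is absorbed as r/(2C), using r ≥ 2C.
  have h4 : r * (ρ - 1 / (2 * C)) ≤ ρ * r - 1 := by
    have : 1 ≤ r * (1 / (2 * C)) := by
      rw [mul_one_div, one_le_div (by positivity)]; exact hr1
    linarith
  have h5 : 0 < r * (ρ - 1 / (2 * C)) := mul_pos hr0 (by linarith)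
  have h6 : (1 - η) * y * (r * (ρ - 1 / (2 * C))) ≤ N * (ρ * r - 1) :=
    mul_le_mul hN h4 h5.le hN0.le
  have h7 : (K : ℝ) * ((1 - η) * (ρ - 1 / (2 * C)) * (x / Real.log x ^ 2)) ≤
      (1 - η) * y * (r * (ρ - 1 / (2 * C))) / 2 := by
    have h8 : (1 - η) * y * (r * (ρ - 1 / (2 * C))) / 2 =
        (K + 1) * ((1 - η) * (ρ - 1 / (2 * C)) * (x / Real.log x ^ 2)) := by
      rw [hr, hy, hH]; field_simp
    rw [h8]
    refine mul_le_mul_of_nonneg_right (by linarith) ?_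
    have := sub_pos.2 hη
    have := sub_pos.2 hη1
    positivity
  linarith

theorem eventually_one_sub_mul_div_log_le_card_oddPrimesLE {η : ℝ} (hη : 0 < η) :
    ∀ᶠ x : ℝ in atTop, (1 - η) * (x / Real.log x) ≤ (oddPrimesLE ⌊x⌋₊).card := by
  have hy : Tendsto (fun x : ℝ => η / 2 * (x / Real.log x)) atTop atTop := by
    refine Tendsto.const_mul_atTop (by positivity) ?_
    have h := (Real.isLittleO_log_id_atTop).tendsto_div_nhds_zero
    have h' : Tendsto (fun x : ℝ => Real.log x / id x) atTop (𝓝[>] 0) := by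
      refine tendsto_nhdsWithin_iff.2 ⟨h, ?_⟩
      filter_upwards [eventually_gt_atTop 1] with x hx
      exact div_pos (Real.log_pos hx) (by simp; linarith)
    refine (h'.inv_tendsto_nhdsGT_zero).congr fun x => ?_
    simp
  filter_upwards [eventually_one_sub_mul_div_log_le_primeCounting (half_pos hη),
    hy.eventually_ge_atTop 1] with x h1 h2
  have h3 : (Nat.primeCounting ⌊x⌋₊ : ℝ) ≤ (oddPrimesLE ⌊x⌋₊).card + 1 := by
    exact_mod_cast primeCounting_le_card_oddPrimesLE_add_one ⌊x⌋₊
  linarith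

theorem mainTheorem4 (C : ℝ) (hC : 1 / 2 < C) (E : ℝ → ℝ)
    (hE : ∀ᶠ x in atTop, C * Real.log x ≤ E x)
    (hEo : E =o[atTop] fun x : ℝ => x / Real.log x ^ 2) :
    AsympGE
      (fun x => (1 / (⌊E x⌋₊ : ℝ)) *
        ∑ k ∈ Finset.Icc 1 ⌊E x⌋₊, (primePairCount (2 * k) x : ℝ))
      (fun x => (1 - 1 / (2 * C)) * (x / Real.log x ^ 2)) := by
  intro ε hε
  have hC0 : 0 < C := by linarith
  have hc : 0 < 1 - 1 / (2 * C) := by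
    rw [sub_pos, div_lt_one (by positivity)]; linarith
  obtain ⟨η, hη0, hη1, hη, hηε⟩ : ∃ η : ℝ, 0 < η ∧ η < 1 ∧ 1 / (2 * C) < (1 - η) / (1 + η) ∧
      (1 - ε) * (1 - 1 / (2 * C)) < (1 - η) * ((1 - η) / (1 + η) - 1 / (2 * C)) := by
    have h1 : ContinuousAt (fun η : ℝ => (1 - η) / (1 + η)) 0 :=
      ContinuousAt.div (by fun_prop) (by fun_prop) (by norm_num)
    have h2 : ContinuousAt (fun η : ℝ => (1 - η) * ((1 - η) / (1 + η) - 1 / (2 * C))) 0 :=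
      ContinuousAt.mul (by fun_prop) (h1.sub continuousAt_const)
    have h3 := h1.eventually_const_lt (u := 1 / (2 * C)) (by simpa using hc)
    have h4 := h2.eventually_const_lt (u := (1 - ε) * (1 - 1 / (2 * C))) (by
      have := mul_pos hε hc
      simp only [sub_zero, add_zero, div_one, one_mul]
      linarith)
    have h9 : ∀ᶠ η in 𝓝[>] (0 : ℝ), 0 < η := self_mem_nhdsWithin
    obtain ⟨η, ⟨⟨h5, h6⟩, h7⟩, h8⟩ := ((((h3.and h4).and
      (eventually_lt_nhds one_pos)).filter_mono nhdsWithin_le_nhds).and h9).exists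
    exact ⟨η, h8, h7, h5, h6⟩
  -- E x ≤ ηx/4 and x ≥ 4/η each give half of 2K + 2 ≤ ηx; log x ≥ 2 gives E x ≥ 1, so the floor
  -- divided by is nonzero.
  filter_upwards [hE, hEo.bound (by positivity : 0 < η / 4),
    eventually_one_sub_mul_div_log_le_card_oddPrimesLE hη0, eventually_gt_atTop 1,
    Real.tendsto_log_atTop.eventually_ge_atTop 2, eventually_ge_atTop (4 / η)]
    with x hEx hEb hN hx hlog hxη
  have hx0 : 0 < x := by linarith
  have hE1 : 1 ≤ E x := by nlinarith
  have hK1 : (1 : ℝ) ≤ ⌊E x⌋₊ := by exact_mod_cast Nat.le_floor (by simpa using hE1)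
  have hKx : 2 * (⌊E x⌋₊ : ℝ) + 2 ≤ η * x := by
    have h1 : (⌊E x⌋₊ : ℝ) ≤ E x := Nat.floor_le (by linarith)
    have h2 : E x ≤ η / 4 * x := by
      rw [Real.norm_of_nonneg (by linarith), Real.norm_of_nonneg (by positivity)] at hEb
      refine hEb.trans (mul_le_mul_of_nonneg_left ?_ (by positivity))
      exact div_le_self hx0.le (by nlinarith)
    rw [div_le_iff₀ hη0] at hxη
    linarith
  have h := le_sum_primePairCount hC hη0 hη1 hη hx
    (hEx.trans (Nat.lt_floor_add_one (E x)).le) hKx hN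
  rw [one_div_mul_eq_div, le_div_iff₀ (by linarith), ← mul_assoc]
  refine le_trans ?_ h
  rw [mul_comm]
  exact mul_le_mul_of_nonneg_left
    (mul_le_mul_of_nonneg_right hηε.le (by positivity)) (by linarith)
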